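/- Let $\mathcal X,\mathcal A$ be nonempty finite sets (states and actions), $\mathcal K=\mathcal X\times\mathcal A$, $P(\cdot|x,a)$ a transition kernel, $c:\mathcal K\to\mathbb R$ a cost, and write $\mathcal L(S)$ for the real functions on a finite set $S$. A *monetary risk measure* on a finite probability space $(S,p)$ is a map $\rho:\mathcal L(S)\to\mathbb R$ with $\rho(v)\le\rho(w)$ whenever $v\le w$ $p$-a.s., $\rho(v+\lambda)=\rho(v)+\lambda$ for $\lambda\in\mathbb R$, and $\rho(0)=0$; it is *coherent* if it is moreover convex and positively homogeneous. A *risk map* $\mathcal R$ assigns to each $(x,a)\in\mathcal K$ a monetary risk measure $\mathcal R_{x,a}(\cdot)=\mathcal R(\cdot|x,a)$ on $(\mathcal X,P(\cdot|x,a))$. For a Markov policy $\boldsymbol\pi=(\pi_0,\pi_1,\dots)$ (each $\pi_t(\cdot|x)$ a probability on $\mathcal A$) put $c^{\pi}(x)=\sum_a\pi(a|x)c(x,a)$, $\mathcal R^{\pi}_x=\sum_a\pi(a|x)\mathcal R_{x,a}$, $$J_T(\boldsymbol\pi)=c^{\pi_0}(X_0)+\mathcal R^{\pi_0}_{X_0}\bigl(c^{\pi_1}(X_1)+\cdots+\mathcal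 R^{\pi_{T-1}}_{X_{T-1}}(c^{\pi_T}(X_T))\cdots\bigr),\qquad J_\infty(\boldsymbol\pi)=\limsup_{T\to\infty}\tfrac1TJ_T(\boldsymbol\pi).$$ A policy is *optimal* if it attains $\inf_{\boldsymbol\pi}J_\infty(\boldsymbol\pi)$ over all Markov policies, for every initial state $X_0=x_0$. The *average risk optimality equation* (AROE) for $(g,h)\in\mathbb R\times\mathcal L(\mathcal X)$ is $$g+h(x)=\min_{a\in\mathcal A}\{c(x,a)+\mathcal R(h|x,a)\},\qquad x\in\mathcal X.$$ For $q\in\mathcal L(\mathcal K)$ let $\mathcal H(q)(x,a)=\mathcal R_{x,a}\bigl(c(x,a)+\min_{a'}q(\cdot,a')\bigr)$. Assume: 1. (Doeblin) there are a coherent risk measure $\nu$ on $\mathcal X$ and $\bar\alpha\in(0,1)$ with $\mathcal R(v|x,a)-\bar\alpha\nu(v)-\mathcal R(v'|x,a)+\bar\alpha\nu(v')\ge0$ for all $v\ge v'$ in $\mathcal L(\mathcal X)$ and all $(x,a)$; 2. $f:\mathcal L(\mathcal K)\to\mathbb R$ satisfies $f(\mathbf 0)=0$, $f(q+\lambda)=f(q)+\lambda$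 and $f(\lambda q)=\lambda f(q)$ for $\lambda\in\mathbb R$, and is Lipschitz for $\|\cdot\|_\infty$; 3. (estimator) $\hat{\mathcal H}(q)=\hat{\mathcal H}(\xi,q)$ is a random operator, jointly measurable in a random sample $\xi$ and in $q$, with $\mathbb E[\hat{\mathcal H}(q)]=\mathcal H(q)$ and, for some $C>0$, $\mathrm{Var}[\hat{\mathcal H}(q)(x,a)]\le C(1+\|q\|_\infty^2)$ for all $(x,a)$ and $q$; 4. (asymptotic coherence) there is a risk map $\mathcal R^\infty$ such that, for all $(x,a)$, $\frac1s\mathcal R_{x,a}(sv)\to\mathcal R^\infty_{x,a}(v)$ as $s\to\infty$ for all $v$, uniformly on compact subsets of $\mathcal L(\mathcal X)$; 5. the step sizes satisfy $\gamma(n)\ge0$, $\sum_n\gamma(n)=\infty$, $\sum_n\gamma(n)^2<\infty$. Let $\xi_0,\xi_1,\dots$ be i.i.d. copies of $\xi$, let $Q_0\in\mathcal L(\mathcal K)$ be arbitrary, and let $$Q_{n+1}=Q_n+\gamma(n)\bigl(\hat{\mathcal H}(\xi_n,Q_n)-f(Q_n)-Q_n\bigr).$$ Then there is $Q^*\in\mathcal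 L(\mathcal K)$ such that $g^*=f(Q^*)$, $h^*(x)=\min_aQ^*(x,a)$ solve the AROE, every stationary deterministic policy $x\mapsto a(x)$ with $a(x)\in\arg\min_aQ^*(x,a)$ for all $x$ is optimal, and almost surely: * $Q_n\to Q^*$; * for every choice of $a_n(x)\in\arg\min_aQ_n(x,a)$, there is a (random) $N$ such that for all $n\ge N$, $a_n(x)\in\arg\min_aQ^*(x,a)$ for all $x$, and the stationary deterministic policy given by the greedy rule $\pi_n(a|x)=\mathbf 1\{a=a_n(x)\}$ is optimal; thus the greedy policies converge to the (finite) set of optimal stationary deterministic policies. If $Q^*(x,\cdot)$ has a unique minimizer $a^*(x)$ for every $x$, then $\pi_n$ converges to the optimal stationary deterministic policy $\pi^*(a|x)=\mathbf 1\{a=a^*(x)\}$. -/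

import Mathlib

open Filter Topology MeasureTheory ProbabilityTheory

namespace RiskAware

noncomputable section

/-- A monetary risk measure on the finite probability space `(X, p)`. Monotonicity is with respect
to the almost sure order, i.e. the order on the points of positive probability. -/
structure IsMonetary {X : Type*} [Fintype X] (p : stdSimplex ℝ X) (ρ : (X → ℝ) → ℝ) : Prop where
  mono : ∀ v w : X → ℝ, (∀ y, 0 < p y → v y ≤ w y) → ρ v ≤ ρ w
  translation : ∀ (v : X → ℝ) (l : ℝ), ρ (fun y => v y + l) = ρ v + l
  normalized : ρ 0 = 0

/-- A coherent risk measure on `(X, p)`: monetary, convex and positively homogeneous. -/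
structure IsCoherent {X : Type*} [Fintype X] (p : stdSimplex ℝ X) (ρ : (X → ℝ) → ℝ) : Prop
    extends IsMonetary p ρ where
  convex : ∀ t : ℝ, 0 ≤ t → t ≤ 1 → ∀ v w : X → ℝ,
    ρ (t • v + (1 - t) • w) ≤ t * ρ v + (1 - t) * ρ w
  posHom : ∀ l : ℝ, 0 ≤ l → ∀ v : X → ℝ, ρ (l • v) = l * ρ v

/-- A risk map for the transition kernel `P`: a monetary risk measure on `(X, P(·|x,a))` for every
state-action pair `(x, a)`. -/
def IsRiskMap {X A : Type*} [Fintype X] (P : X → A → stdSimplex ℝ X)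
    (R : X → A → (X → ℝ) → ℝ) : Prop :=
  ∀ x a, IsMonetary (P x a) (R x a)

/-- The Doeblin type condition: there are a coherent risk measure `ν` on `X` and `α ∈ (0, 1)` with
`R(v|x,a) - α ν(v) - R(v'|x,a) + α ν(v') ≥ 0` for all `v ≥ v'` and all `(x, a)`. -/
def Doeblin {X A : Type*} [Fintype X] (R : X → A → (X → ℝ) → ℝ) : Prop :=
  ∃ (p : stdSimplex ℝ X) (ν : (X → ℝ) → ℝ) (α : ℝ), IsCoherent p ν ∧ 0 < α ∧ α < 1 ∧
    ∀ v v' : X → ℝ, v' ≤ v → ∀ x a, 0 ≤ R x a v - α * ν v - R x a v' + α * ν v'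

/-- Asymptotic coherence: `R_{x,a}(s v) / s` converges as `s → ∞`, for all `v` and uniformly on
compact sets, to `R∞_{x,a}(v)` for some risk map `R∞`. -/
def AsymptoticallyCoherent {X A : Type*} [Fintype X] (P : X → A → stdSimplex ℝ X)
    (R : X → A → (X → ℝ) → ℝ) : Prop :=
  ∃ Rinf : X → A → (X → ℝ) → ℝ, IsRiskMap P Rinf ∧ ∀ x a,
    (∀ v : X → ℝ, Tendsto (fun s : ℝ => 1 / s * R x a (s • v)) atTop (𝓝 (Rinf x a v))) ∧
    ∀ K : Set (X → ℝ), IsCompact K →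
      TendstoUniformlyOn (fun (s : ℝ) (v : X → ℝ) => 1 / s * R x a (s • v)) (Rinf x a) atTop K

/-- `min_{a} q(x, a)`. -/
def minAct {X A : Type*} [Fintype A] [Nonempty A] (q : X × A → ℝ) (x : X) : ℝ :=
  Finset.univ.inf' Finset.univ_nonempty fun a => q (x, a)

/-- The risk-aware Bellman optimality operator for Q-factors,
`H(q)(x,a) = R_{x,a}(c(x,a) + min_{a'} q(·,a'))`. -/
def bellmanQ {X A : Type*} [Fintype A] [Nonempty A] (c : X → A → ℝ)
    (R : X → A → (X → ℝ) → ℝ) (q : X × A → ℝ) : X × A → ℝ :=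
  fun k => R k.1 k.2 fun y => c k.1 k.2 + minAct q y

/-- The average risk optimality equation `g + h(x) = min_a {c(x,a) + R(h|x,a)}`. -/
def SolvesAROE {X A : Type*} [Fintype A] [Nonempty A] (c : X → A → ℝ)
    (R : X → A → (X → ℝ) → ℝ) (g : ℝ) (h : X → ℝ) : Prop :=
  ∀ x, g + h x = Finset.univ.inf' Finset.univ_nonempty fun a => c x a + R x a h

/-- A decision rule: a probability vector on actions for every state. -/
abbrev DecisionRule (X A : Type*) [Fintype A] : Type _ := X → stdSimplex ℝ A

/-- A (randomized, possibly time-dependent) Markov policy. -/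
abbrev Policy (X A : Type*) [Fintype A] : Type _ := ℕ → DecisionRule X A

/-- The deterministic decision rule that chooses `a x` in state `x` with probability one. -/
def deterministic {X A : Type*} [Fintype A] (a : X → A) : DecisionRule X A :=
  open Classical in fun x => stdSimplex.vertex (a x)

/-- The stationary policy that uses the decision rule `π` at all times. -/
def stationary {X A : Type*} [Fintype A] (π : DecisionRule X A) : Policy X A := fun _ => π

/-- The `T`-stage total risk from initial state `x`, namely
`J_T(π) = c^{π₀}(X₀) + R^{π₀}_{X₀}(c^{π₁}(X₁) + ⋯ + R^{π_{T-1}}_{X_{T-1}}(c^{π_T}(X_T)) ⋯)` with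
`X₀ = x`, where `c^π(x) = ∑ₐ π(a|x) c(x,a)` and `R^π_x(v) = ∑ₐ π(a|x) R_{x,a}(v)`. -/
def totalRisk {X A : Type*} [Fintype A] (c : X → A → ℝ) (R : X → A → (X → ℝ) → ℝ) :
    ℕ → Policy X A → X → ℝ
  | 0, π, x => ∑ a, π 0 x a * c x a
  | T + 1, π, x => ∑ a, π 0 x a * c x a +
      ∑ a, π 0 x a * R x a (totalRisk c R T fun t => π (t + 1))

/-- The infinite horizon average risk `limsup_T J_T(π) / T` from initial state `x`. -/
def averageRisk {X A : Type*} [Fintype A] (c : X → A → ℝ) (R : X → A → (X → ℝ) → ℝ)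
    (π : Policy X A) (x : X) : EReal :=
  limsup (fun T : ℕ => ((1 / (T : ℝ) * totalRisk c R T π x : ℝ) : EReal)) atTop

/-- `π` attains the infimum of the average risk over all Markov policies, from every initial
state. -/
def IsOptimalPolicy {X A : Type*} [Fintype A] (c : X → A → ℝ) (R : X → A → (X → ℝ) → ℝ)
    (π : Policy X A) : Prop :=
  ∀ x₀, averageRisk c R π x₀ = ⨅ π' : Policy X A, averageRisk c R π' x₀

/-- `a` selects in every state a minimizer of `q(x, ·)`. -/
def IsGreedy {X A : Type*} (q : X × A → ℝ) (a : X → A) : Prop :=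
  ∀ x b, q (x, a x) ≤ q (x, b)

/-- The estimator `q ↦ Hhat(·, q)`, a random operator on Q-factors driven by a random sample with
law `ℓ`, is an unbiased estimator of `H`, and its variance grows at most quadratically
(`‖q‖` is the supremum norm). -/
def IsUnbiasedEstimator {X A E : Type*} [Fintype X] [Fintype A] [MeasurableSpace E]
    (ℓ : Measure E) (Hhat : E → (X × A → ℝ) → (X × A → ℝ))
    (H : (X × A → ℝ) → (X × A → ℝ)) : Prop :=
  (∀ q k, MemLp (fun e => Hhat e q k) 2 ℓ ∧ ∫ e, Hhat e q k ∂ℓ = H q k) ∧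
    ∃ C : ℝ, 0 < C ∧ ∀ q k, variance (fun e => Hhat e q k) ℓ ≤ C * (1 + ‖q‖ ^ 2)

/-- The Q-learning iterates
`Q_{n+1} = Q_n + γ(n) (Hhat(ξ_n, Q_n) - f(Q_n) - Q_n)` started from `q₀`, where `ξ_n` is the sample
drawn at step `n`. -/
def qIter {X A E : Type*} (Hhat : E → (X × A → ℝ) → (X × A → ℝ)) (f : (X × A → ℝ) → ℝ)
    (γ : ℕ → ℝ) (q₀ : X × A → ℝ) (ξ : ℕ → E) : ℕ → X × A → ℝ
  | 0 => q₀
  | n + 1 => fun k => qIter Hhat f γ q₀ ξ n k +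
      γ n * (Hhat (ξ n) (qIter Hhat f γ q₀ ξ n) k - f (qIter Hhat f γ q₀ ξ n)
        - qIter Hhat f γ q₀ ξ n k)

end

end RiskAware

/-! The iteration is stochastic approximation for the fixed point of `T q = H q - f q`, with `H` the
Bellman operator. The Doeblin condition makes `R - α ν` monotone; since `ν` does not depend on the
state-action pair, `H` contracts the span by `1 - α`. Adding a constant to `q` does not change `T
q`, so the remaining direction is harmless: `T` contracts the norm `max (K * span q) |q k₀|` once
`K` is large (`exists_contraction`). Its fixed point `Q*` satisfies `H Q* = Q* + f Q*`, and
minimizing over actions gives the AROE. A verification induction then traps the `T`-stage risk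
between affine functions of `T` with slope `g`, so greedy policies for `Q*` are optimal.

For convergence, the contraction norm `N` is not smooth, so `N ^ 2` is replaced by its Moreau
envelope `V`, which has a quadratic upper bound and satisfies `V ≤ N ^ 2 ≤ B V` with `B` so close to
1 that `β ^ 2 * B < 1`. Hence `V (Q n - Q*)` shrinks in conditional mean by a factor `1 - c γ + C γ
^ 2`, up to an additive `C γ ^ 2` (`exists_lyapunov`). Noise of quadratically growing variance is
absorbed by the `γ ^ 2` terms, so no separate stability argument is required. Supermartingale
convergence gives `Q n → Q*`.

There are finitely many strict inequalities between the values of `Q*`, and each persists for `Q n`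
near `Q*`. Hence eventually every minimizer for `Q n` is one for `Q*`. -/

namespace RiskAware

/-! ### Smoothing a squared seminorm by its Moreau envelope -/

section Moreau

variable {ι : Type*} [Fintype ι]

theorem norm_sq_le_dotProduct_self (x : ι → ℝ) : ‖x‖ ^ 2 ≤ x ⬝ᵥ x := by
  have h0 : 0 ≤ x ⬝ᵥ x := Finset.sum_nonneg fun i _ => mul_self_nonneg _
  have h : ‖x‖ ≤ √(x ⬝ᵥ x) := by
    refine (pi_norm_le_iff_of_nonneg (Real.sqrt_nonneg _)).2 fun i => ?_
    refine Real.abs_le_sqrt ?_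
    rw [pow_two]
    exact Finset.single_le_sum (f := fun i => x i * x i) (fun i _ => mul_self_nonneg _)
      (Finset.mem_univ i)
  calc ‖x‖ ^ 2 ≤ √(x ⬝ᵥ x) ^ 2 := by gcongr
    _ = x ⬝ᵥ x := Real.sq_sqrt h0

theorem dotProduct_self_le (x : ι → ℝ) : x ⬝ᵥ x ≤ Fintype.card ι * ‖x‖ ^ 2 := by
  calc x ⬝ᵥ x ≤ ∑ _i : ι, ‖x‖ ^ 2 := by
        refine Finset.sum_le_sum fun i _ => ?_
        rw [← pow_two, ← sq_abs]
        have := norm_le_pi_norm x i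
        rw [Real.norm_eq_abs] at this
        gcongr
    _ = Fintype.card ι * ‖x‖ ^ 2 := by simp

theorem dotProduct_self_nonneg_real (x : ι → ℝ) : 0 ≤ x ⬝ᵥ x :=
  Finset.sum_nonneg fun _ _ => mul_self_nonneg _

theorem dotProduct_self_add (x y : ι → ℝ) :
    (x + y) ⬝ᵥ (x + y) = x ⬝ᵥ x + 2 * (x ⬝ᵥ y) + y ⬝ᵥ y := by
  rw [add_dotProduct, dotProduct_add, dotProduct_add, dotProduct_comm y x]
  ring

theorem dotProduct_self_add_le (x y : ι → ℝ) :
    (x + y) ⬝ᵥ (x + y) ≤ 2 * (x ⬝ᵥ x) + 2 * (y ⬝ᵥ y) := by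
  have h := dotProduct_self_nonneg_real (x + -y)
  rw [dotProduct_self_add] at h ⊢
  simp only [dotProduct_neg, neg_dotProduct, neg_neg] at h
  linarith

theorem continuous_of_seminorm_le (N : Seminorm ℝ (ι → ℝ)) {b : ℝ}
    (hN : ∀ x, N x ≤ b * ‖x‖) : Continuous N := by
  refine Seminorm.continuous' (r := |b| + 1) ?_
  rw [Seminorm.closedBall_zero_eq]
  refine Filter.mem_of_superset (Metric.ball_mem_nhds (0 : ι → ℝ) one_pos) fun x hx => ?_
  have hx' : ‖x‖ < 1 := by simpa using hx
  have h1 := hN x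
  have h2 : b * ‖x‖ ≤ |b| * 1 :=
    mul_le_mul (le_abs_self b) hx'.le (norm_nonneg _) (abs_nonneg _)
  show N x ≤ _
  linarith

theorem exists_prox (N : Seminorm ℝ (ι → ℝ)) {b : ℝ} (hN : ∀ x, N x ≤ b * ‖x‖) {κ : ℝ}
    (hκ : 0 < κ) (x : ι → ℝ) :
    ∃ u, ∀ w, N u ^ 2 + κ * ((x - u) ⬝ᵥ (x - u)) ≤ N w ^ 2 + κ * ((x - w) ⬝ᵥ (x - w)) := by
  have hc : Continuous fun w => N w ^ 2 + κ * ((x - w) ⬝ᵥ (x - w)) := by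
    have := continuous_of_seminorm_le N hN
    unfold dotProduct
    fun_prop
  refine hc.exists_forall_le' x ?_
  have h1 : Tendsto (fun w => dist w x) (cocompact (ι → ℝ)) atTop :=
    tendsto_dist_right_cocompact_atTop x
  have h2 : Tendsto (fun w => κ * dist w x ^ 2) (cocompact (ι → ℝ)) atTop :=
    ((tendsto_pow_atTop two_ne_zero).comp h1).const_mul_atTop hκ
  filter_upwards [h2.eventually_ge_atTop (N x ^ 2)] with w hw
  have h3 := norm_sq_le_dotProduct_self (x - w)
  rw [dist_comm, dist_eq_norm] at hw
  have h4 : κ * ‖x - w‖ ^ 2 ≤ κ * ((x - w) ⬝ᵥ (x - w)) := by gcongr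
  have h5 := sq_nonneg (N w)
  simp only [sub_self, dotProduct_zero, mul_zero, add_zero]
  linarith

/-- The first order optimality condition for the proximal point of a squared seminorm. -/
theorem prox_variational (N : Seminorm ℝ (ι → ℝ)) {κ : ℝ} {x u : ι → ℝ}
    (hu : ∀ w, N u ^ 2 + κ * ((x - u) ⬝ᵥ (x - u)) ≤ N w ^ 2 + κ * ((x - w) ⬝ᵥ (x - w)))
    (w : ι → ℝ) : 2 * κ * ((x - u) ⬝ᵥ (w - u)) ≤ N w ^ 2 - N u ^ 2 := by
  -- Compare `u` with `u + t (w - u)`: convexity of `N ^ 2` bounds the change of the first term by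
  -- `t (N w ^ 2 - N u ^ 2)`. Dividing by `t` leaves an error of order `t`, which vanishes in the
  -- limit.
  have key : ∀ t : ℝ, 0 < t → t ≤ 1 →
      0 ≤ N w ^ 2 - N u ^ 2 - 2 * κ * ((x - u) ⬝ᵥ (w - u))
        + t * (κ * ((w - u) ⬝ᵥ (w - u))) := by
    intro t ht ht1
    have h1 := hu (u + t • (w - u))
    have h2 : N (u + t • (w - u)) ≤ (1 - t) * N u + t * N w := by
      have : u + t • (w - u) = (1 - t) • u + t • w := by
        ext i; simp; ring
      rw [this]
      refine (map_add_le_add N _ _).trans ?_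
      rw [map_smul_eq_mul, map_smul_eq_mul, Real.norm_of_nonneg ht.le,
        Real.norm_of_nonneg (by linarith)]
    have h3 : N (u + t • (w - u)) ^ 2 ≤ (1 - t) * N u ^ 2 + t * N w ^ 2 := by
      have h0 : 0 ≤ N (u + t • (w - u)) := apply_nonneg N _
      calc N (u + t • (w - u)) ^ 2 ≤ ((1 - t) * N u + t * N w) ^ 2 := by gcongr
        _ ≤ (1 - t) * N u ^ 2 + t * N w ^ 2 := by
          nlinarith [mul_nonneg (mul_nonneg ht.le (by linarith : 0 ≤ 1 - t))
            (sq_nonneg (N u - N w))]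
    have h4 : (x - (u + t • (w - u))) ⬝ᵥ (x - (u + t • (w - u))) =
        (x - u) ⬝ᵥ (x - u) - 2 * t * ((x - u) ⬝ᵥ (w - u)) + t ^ 2 * ((w - u) ⬝ᵥ (w - u)) := by
      have : x - (u + t • (w - u)) = (x - u) + (-t) • (w - u) := by module
      rw [this, dotProduct_self_add]
      simp only [smul_dotProduct, dotProduct_smul, smul_eq_mul]
      ring
    rw [h4] at h1
    have h5 : 0 ≤ t * (N w ^ 2 - N u ^ 2 - 2 * κ * ((x - u) ⬝ᵥ (w - u))
        + t * (κ * ((w - u) ⬝ᵥ (w - u)))) := by nlinarith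
    exact nonneg_of_mul_nonneg_right h5 ht
  have hlim : Tendsto (fun t : ℝ => N w ^ 2 - N u ^ 2 - 2 * κ * ((x - u) ⬝ᵥ (w - u))
        + t * (κ * ((w - u) ⬝ᵥ (w - u)))) (𝓝[>] 0)
        (𝓝 (N w ^ 2 - N u ^ 2 - 2 * κ * ((x - u) ⬝ᵥ (w - u))
        + 0 * (κ * ((w - u) ⬝ᵥ (w - u))))) :=
    ((continuous_const.add (continuous_id.mul continuous_const)).tendsto 0).mono_left
      nhdsWithin_le_nhds
  have h0 := ge_of_tendsto hlim (by
    filter_upwards [Ioc_mem_nhdsGT (zero_lt_one' ℝ)] with t ht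
    exact key t ht.1 ht.2)
  linarith

/-- The Moreau envelope of a squared seminorm: a convex function with a quadratic upper bound that
is equivalent to the squared seminorm, with constants as close to one as desired. -/
theorem exists_moreau_envelope (N : Seminorm ℝ (ι → ℝ)) {b : ℝ}
    (hN : ∀ x, N x ≤ b * ‖x‖) {κ : ℝ} (hκ : 0 < κ) :
    ∃ (V : (ι → ℝ) → ℝ) (G : (ι → ℝ) → ι → ℝ),
      (∀ x y, V (x + y) ≤ V x + G x ⬝ᵥ y + κ * (y ⬝ᵥ y)) ∧
      (∀ x y, V x + G x ⬝ᵥ (y - x) ≤ V y) ∧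
      (∀ x, V x ≤ N x ^ 2) ∧ (∀ x, N x ^ 2 ≤ (1 + b ^ 2 / κ) * V x) ∧ Continuous V := by
  choose u hu using exists_prox N hN hκ
  set V : (ι → ℝ) → ℝ := fun x => N (u x) ^ 2 + κ * ((x - u x) ⬝ᵥ (x - u x)) with hV
  set G : (ι → ℝ) → ι → ℝ := fun x => (2 * κ) • (x - u x) with hG
  -- The minimizer for `x` is a competitor in the minimum defining `V (x + y)`.
  have h1 : ∀ x y, V (x + y) ≤ V x + G x ⬝ᵥ y + κ * (y ⬝ᵥ y) := by
    intro x y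
    have := hu (x + y) (u x)
    have e : x + y - u x = (x - u x) + y := by abel
    rw [e, dotProduct_self_add] at this
    simp only [hV, hG, smul_dotProduct, smul_eq_mul]
    linarith
  -- The gap is the slack in the variational inequality at `u x`, tested with `u y`, plus `κ` times
  -- the square of `(y - u y) - (x - u x)`.
  have h2 : ∀ x y, V x + G x ⬝ᵥ (y - x) ≤ V y := by
    intro x y
    have ha := prox_variational N (hu x) (u y)
    have hq := mul_nonneg hκ.le (dotProduct_self_nonneg_real ((y - u y) + -(x - u x)))
    have e : y - x = (y - u y) + -(x - u x) + (u y - u x) := by abel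
    simp only [hV, hG]
    rw [e, smul_dotProduct, dotProduct_add, dotProduct_add, smul_eq_mul, dotProduct_neg]
    rw [dotProduct_self_add, neg_dotProduct, dotProduct_neg, dotProduct_neg,
      dotProduct_comm (y - u y) (x - u x)] at hq
    linarith
  have hVcont : Continuous V := by
    refine continuous_iff_continuousAt.2 fun x => ?_
    have hlo : Tendsto (fun y => V x + G x ⬝ᵥ (y - x)) (𝓝 x) (𝓝 (V x)) := by
      have : Continuous fun y => V x + G x ⬝ᵥ (y - x) := by unfold dotProduct; fun_prop
      simpa using this.tendsto x
    have hhi : Tendsto (fun y => V x + G x ⬝ᵥ (y - x) + κ * ((y - x) ⬝ᵥ (y - x))) (𝓝 x)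
        (𝓝 (V x)) := by
      have : Continuous fun y => V x + G x ⬝ᵥ (y - x) + κ * ((y - x) ⬝ᵥ (y - x)) := by
        unfold dotProduct; fun_prop
      simpa using this.tendsto x
    refine tendsto_of_tendsto_of_tendsto_of_le_of_le hlo hhi (fun y => h2 x y) fun y => ?_
    simpa using h1 x (y - x)
  refine ⟨V, G, h1, h2, fun x => ?_, fun x => ?_, hVcont⟩
  · have h := hu x x
    rwa [sub_self x, dotProduct_zero, mul_zero, add_zero] at h
  · have ht : N x ≤ N (u x) + b * ‖x - u x‖ := by
      calc N x = N (u x + (x - u x)) := by congr 1; abel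
        _ ≤ N (u x) + N (x - u x) := map_add_le_add N _ _
        _ ≤ _ := by gcongr; exact hN _
    have hn := norm_sq_le_dotProduct_self (x - u x)
    have h0 : 0 ≤ N x := apply_nonneg N _
    calc N x ^ 2 ≤ (N (u x) + b * ‖x - u x‖) ^ 2 := by gcongr
      _ ≤ (1 + b ^ 2 / κ) * (N (u x) ^ 2 + κ * ‖x - u x‖ ^ 2) := by
        -- Weighted Cauchy–Schwarz, with its defect written as a square.
        have : (1 + b ^ 2 / κ) * (N (u x) ^ 2 + κ * ‖x - u x‖ ^ 2)
            - (N (u x) + b * ‖x - u x‖) ^ 2 = (b * N (u x) - κ * ‖x - u x‖) ^ 2 / κ := by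
          field_simp
          ring
        have h3 : 0 ≤ (b * N (u x) - κ * ‖x - u x‖) ^ 2 / κ := by positivity
        linarith
      _ ≤ (1 + b ^ 2 / κ) * V x := by
        simp only [hV]
        gcongr

end Moreau

/-! ### Convergence of almost supermartingales -/

section Supermartingale

theorem frequently_lt_of_sum_mul_bounded {γ v : ℕ → ℝ} (hγ : ∀ n, 0 ≤ γ n)
    (hγ_sum : Tendsto (fun N => ∑ n ∈ Finset.range N, γ n) atTop atTop) (hv : ∀ n, 0 ≤ v n)
    {B : ℝ} (hB : ∀ N, ∑ n ∈ Finset.range N, γ n * v n ≤ B) {ε : ℝ} (hε : 0 < ε) :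
    ∃ᶠ n in atTop, v n < ε := by
  intro hcon
  simp only [not_lt] at hcon
  obtain ⟨M, hM⟩ := eventually_atTop.1 hcon
  have hlim : Tendsto (fun N => ε * (∑ n ∈ Finset.range N, γ n - ∑ n ∈ Finset.range M, γ n))
      atTop atTop :=
    (tendsto_atTop_add_const_right _ _ hγ_sum).const_mul_atTop hε
  obtain ⟨N, hN, hNM⟩ := ((hlim.eventually_gt_atTop B).and (eventually_ge_atTop M)).exists
  have h1 : ∑ n ∈ Finset.range N, γ n - ∑ n ∈ Finset.range M, γ n = ∑ n ∈ Finset.Ico M N, γ n :=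
    (Finset.sum_Ico_eq_sub _ hNM).symm
  have h2 : ε * ∑ n ∈ Finset.Ico M N, γ n ≤ ∑ n ∈ Finset.Ico M N, γ n * v n := by
    rw [Finset.mul_sum]
    refine Finset.sum_le_sum fun n hn => ?_
    rw [mul_comm]
    exact mul_le_mul_of_nonneg_left (hM n (Finset.mem_Ico.1 hn).1) (hγ n)
  have h3 : ∑ n ∈ Finset.Ico M N, γ n * v n ≤ ∑ n ∈ Finset.range N, γ n * v n := by
    refine Finset.sum_le_sum_of_subset_of_nonneg (fun n hn => ?_) fun n _ _ =>
      mul_nonneg (hγ n) (hv n)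
    exact Finset.mem_range.2 (Finset.mem_Ico.1 hn).2
  rw [h1] at hN
  linarith [hB N]

/-- A nonnegative process with `E[V (n+1) | ℱ n] ≤ (1 - c γ n + C (γ n)^2) V n + C (γ n)^2`, where
`∑ γ n = ∞` and `∑ (γ n)^2 < ∞`, tends to zero almost surely. -/
theorem ae_tendsto_zero_of_almost_supermartingale {Ω : Type*} {m0 : MeasurableSpace Ω}
    {μ : Measure Ω} [IsProbabilityMeasure μ] (ℱ : Filtration ℕ m0) {V : ℕ → Ω → ℝ}
    (hadp : StronglyAdapted ℱ V) (hint : ∀ n, Integrable (V n) μ) (hnn : ∀ n ω, 0 ≤ V n ω)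
    {γ : ℕ → ℝ} (hγ : ∀ n, 0 ≤ γ n)
    (hγ_sum : Tendsto (fun N => ∑ n ∈ Finset.range N, γ n) atTop atTop)
    (hγ_sq : Summable fun n => γ n ^ 2) {c C : ℝ} (hc : 0 < c) (hC : 0 ≤ C)
    (hV : ∀ n s, MeasurableSet[ℱ n] s → ∫ ω in s, V (n + 1) ω ∂μ ≤
      ∫ ω in s, ((1 - c * γ n + C * γ n ^ 2) * V n ω + C * γ n ^ 2) ∂μ) :
    ∀ᵐ ω ∂μ, Tendsto (fun n => V n ω) atTop (𝓝 0) := by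
  -- This discount absorbs the factors `1 + C γ ^ 2`; square summability keeps it above `δ > 0`.
  set e : ℕ → ℝ := fun n => Real.exp (-(C * ∑ i ∈ Finset.range n, γ i ^ 2)) with he
  set δ : ℝ := Real.exp (-(C * ∑' i, γ i ^ 2)) with hδ
  have hδ0 : 0 < δ := Real.exp_pos _
  have he0 : ∀ n, 0 < e n := fun n => Real.exp_pos _
  have he_lim : Tendsto e atTop (𝓝 δ) :=
    (Real.continuous_exp.tendsto _).comp
      ((hγ_sq.hasSum.tendsto_sum_nat.const_mul C).neg)
  have hδe : ∀ n, δ ≤ e n := fun n => by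
    refine Real.exp_le_exp.2 (neg_le_neg (mul_le_mul_of_nonneg_left ?_ hC))
    exact hγ_sq.sum_le_tsum _ fun i _ => sq_nonneg _
  have he_succ : ∀ n, e (n + 1) * (1 + C * γ n ^ 2) ≤ e n := fun n => by
    have h1 : e n = e (n + 1) * Real.exp (C * γ n ^ 2) := by
      simp only [he]
      rw [← Real.exp_add, Finset.sum_range_succ]
      congr 1
      ring
    rw [h1]
    refine mul_le_mul_of_nonneg_left ?_ (he0 _).le
    linarith [Real.add_one_le_exp (C * γ n ^ 2)]
  -- The `+ 1` turns the additive error `C γ ^ 2` into part of the same factor, so `S` is a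
  -- supermartingale that loses at least `δ c γ n E[V n]` in mean at each step.
  set S : ℕ → Ω → ℝ := fun n ω => e n * (V n ω + 1) with hS
  have hSint : ∀ n, Integrable (S n) μ := fun n =>
    ((hint n).add (integrable_const 1)).const_mul _
  have hSnn : ∀ n ω, 0 ≤ S n ω := fun n ω => mul_nonneg (he0 n).le (by linarith [hnn n ω])
  have hSs : ∀ n (s : Set Ω), ∫ ω in s, S n ω ∂μ = e n * (∫ ω in s, V n ω ∂μ + μ.real s) := by
    intro n s
    simp only [hS]
    rw [integral_const_mul, integral_add (hint n).integrableOn (integrable_const _)]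
    simp
  have hstep : ∀ n s, MeasurableSet[ℱ n] s → ∫ ω in s, S (n + 1) ω ∂μ ≤
      ∫ ω in s, S n ω ∂μ - δ * c * (γ n * ∫ ω in s, V n ω ∂μ) := by
    intro n s hs
    have h1 := hV n s hs
    rw [integral_add ((hint n).const_mul _).integrableOn (integrable_const _),
      integral_const_mul, integral_const, smul_eq_mul, measureReal_restrict_apply_univ] at h1
    rw [hSs, hSs]
    have h2 : 0 ≤ ∫ ω in s, V n ω ∂μ := integral_nonneg (hnn n)
    have h3 : 0 ≤ μ.real s := measureReal_nonneg
    have h4 := mul_le_mul_of_nonneg_left h1 (he0 (n + 1)).le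
    have h5 := mul_le_mul_of_nonneg_right (he_succ n)
      (add_nonneg h2 h3)
    have h6 := mul_le_mul_of_nonneg_right (hδe (n + 1))
      (mul_nonneg hc.le (mul_nonneg (hγ n) h2))
    nlinarith
  have hsub : Submartingale (fun n ω => -S n ω) ℱ μ := by
    refine submartingale_of_setIntegral_le_succ (fun n => ?_) (fun n => (hSint n).neg) ?_
    · exact (((hadp n).add stronglyMeasurable_const).const_mul _).neg
    · intro n s hs
      rw [integral_neg, integral_neg, neg_le_neg_iff]
      have h2 : 0 ≤ ∫ ω in s, V n ω ∂μ := integral_nonneg (hnn n)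
      have h3 : 0 ≤ δ * c * (γ n * ∫ ω in s, V n ω ∂μ) := by have := hγ n; positivity
      linarith [hstep n s hs]
  have hstep' : ∀ n, ∫ ω, S (n + 1) ω ∂μ ≤ ∫ ω, S n ω ∂μ - δ * c * (γ n * ∫ ω, V n ω ∂μ) :=
    fun n => by simpa using hstep n Set.univ MeasurableSet.univ
  have hEV : ∀ n, 0 ≤ ∫ ω, V n ω ∂μ := fun n => integral_nonneg (hnn n)
  have htel : ∀ N, ∫ ω, S N ω ∂μ + δ * c * ∑ n ∈ Finset.range N, γ n * ∫ ω, V n ω ∂μ ≤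
      ∫ ω, S 0 ω ∂μ := by
    intro N
    induction N with
    | zero => simp
    | succ N ih =>
      rw [Finset.sum_range_succ, mul_add]
      linarith [hstep' N]
  have hsum0 : ∀ N, 0 ≤ ∑ n ∈ Finset.range N, γ n * ∫ ω, V n ω ∂μ := fun N =>
    Finset.sum_nonneg fun n _ => mul_nonneg (hγ n) (hEV n)
  have hconv : ∀ᵐ ω ∂μ, ∃ l, Tendsto (fun n => -S n ω) atTop (𝓝 l) := by
    refine hsub.exists_ae_tendsto_of_bdd (R := (∫ ω, S 0 ω ∂μ).toNNReal) fun n => ?_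
    have h1 : eLpNorm (fun ω => -S n ω) 1 μ = ENNReal.ofReal (∫ ω, S n ω ∂μ) := by
      rw [eLpNorm_one_eq_lintegral_enorm,
        ofReal_integral_eq_lintegral_ofReal (hSint n) (ae_of_all _ (hSnn n))]
      refine lintegral_congr fun ω => ?_
      rw [enorm_neg, Real.enorm_of_nonneg (hSnn n ω)]
    rw [h1]
    refine ENNReal.ofReal_le_ofReal ?_
    have := mul_nonneg (mul_nonneg hδ0.le hc.le) (hsum0 n)
    linarith [htel n]
  have hfreq : ∀ ε : ℝ, 0 < ε → ∃ᶠ n in atTop, ∫ ω, V n ω ∂μ < ε := by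
    intro ε hε
    refine frequently_lt_of_sum_mul_bounded hγ hγ_sum hEV
      (B := (∫ ω, S 0 ω ∂μ) / (δ * c)) (fun N => ?_) hε
    rw [le_div_iff₀ (by positivity), mul_comm]
    have : 0 ≤ ∫ ω, S N ω ∂μ := integral_nonneg (hSnn N)
    linarith [htel N]
  have hVm : ∀ n, Measurable (V n) := fun n => ((hadp n).mono (ℱ.le n)).measurable
  -- The means of `V n` are small infinitely often, so Fatou gives a zero lower limit; as `S`, and
  -- hence `V`, converges almost surely, this identifies the limit.
  have hfatou : ∫⁻ ω, liminf (fun n => ENNReal.ofReal (V n ω)) atTop ∂μ = 0 := by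
    refine le_antisymm ?_ zero_le
    refine (lintegral_liminf_le fun n => (hVm n).ennreal_ofReal).trans ?_
    refine ENNReal.le_of_forall_pos_le_add fun ε hε _ => ?_
    rw [zero_add]
    refine liminf_le_of_frequently_le' ?_
    refine (hfreq ε (by exact_mod_cast hε)).mono fun n hn => ?_
    rw [← ofReal_integral_eq_lintegral_ofReal (hint n) (ae_of_all _ (hnn n))]
    rw [← ENNReal.ofReal_coe_nnreal]
    exact ENNReal.ofReal_le_ofReal hn.le
  rw [lintegral_eq_zero_iff (Measurable.liminf fun n => (hVm n).ennreal_ofReal)] at hfatou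
  filter_upwards [hconv, hfatou] with ω ⟨l, hl⟩ hω
  have h1 : Tendsto (fun n => V n ω) atTop (𝓝 (-l / δ - 1)) := by
    have h2 := (hl.neg.div he_lim hδ0.ne').sub_const 1
    refine h2.congr fun n => ?_
    simp only [hS, Pi.div_apply, neg_neg]
    have := (he0 n).ne'
    field_simp
    ring
  have h2 : Tendsto (fun n => ENNReal.ofReal (V n ω)) atTop (𝓝 (ENNReal.ofReal (-l / δ - 1))) :=
    (ENNReal.continuous_ofReal.tendsto _).comp h1
  rw [Pi.zero_apply, h2.liminf_eq, ENNReal.ofReal_eq_zero] at hω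
  have h3 : 0 ≤ -l / δ - 1 := ge_of_tendsto' h1 fun n => hnn n ω
  rwa [le_antisymm hω h3] at h1

end Supermartingale

/-! ### Stochastic approximation for contractions -/

section StochasticApproximation

/-- Freezing: a fresh sample may be integrated out with the past held fixed. It plays the role of a
conditional expectation, and needs no integrability because `φ` is `ENNReal`-valued. -/
theorem setLIntegral_comp_of_indep {Ω β E : Type*} {m m0 : MeasurableSpace Ω}
    [MeasurableSpace β] [MeasurableSpace E] {μ : Measure Ω} [IsProbabilityMeasure μ]
    (hm : m ≤ m0) {Y : Ω → β} (hY : Measurable[m] Y) {Z : Ω → E} (hZ : Measurable Z)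
    (hind : Indep m (MeasurableSpace.comap Z inferInstance) μ)
    {φ : β × E → ENNReal} (hφ : Measurable φ) {s : Set Ω} (hs : MeasurableSet[m] s) :
    ∫⁻ ω in s, φ (Y ω, Z ω) ∂μ = ∫⁻ ω in s, ∫⁻ e, φ (Y ω, e) ∂(μ.map Z) ∂μ := by
  -- Recording membership in `s` as a coordinate lets a single product law handle the restriction as
  -- well.
  set Y' : Ω → β × Prop := fun ω => (Y ω, ω ∈ s) with hY'
  have hY'm : Measurable[m] Y' := hY.prodMk ((@measurable_mem Ω s m).2 hs)
  have hY'm0 : Measurable Y' := hY'm.mono hm le_rfl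
  have hindF : IndepFun Y' Z μ := by
    rw [IndepFun_iff_Indep]
    exact indep_of_indep_of_le_left hind (measurable_iff_comap_le.1 hY'm)
  have hprod := (indepFun_iff_map_prod_eq_prod_map_map hY'm0.aemeasurable hZ.aemeasurable).1 hindF
  have hA : MeasurableSet {p : (β × Prop) × E | p.1.2} :=
    measurableSet_setOfPred.2 (measurable_snd.comp measurable_fst)
  set ψ : (β × Prop) × E → ENNReal :=
    {p : (β × Prop) × E | p.1.2}.indicator fun p => φ (p.1.1, p.2) with hψ
  have hψm : Measurable ψ := by
    refine Measurable.indicator (hφ.comp ?_) hA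
    exact (measurable_fst.comp measurable_fst).prodMk measurable_snd
  have : IsProbabilityMeasure (μ.map Z) := Measure.isProbabilityMeasure_map hZ.aemeasurable
  rw [← lintegral_indicator (hm _ hs), ← lintegral_indicator (hm _ hs)]
  calc ∫⁻ ω, s.indicator (fun ω => φ (Y ω, Z ω)) ω ∂μ
      = ∫⁻ ω, ψ (Y' ω, Z ω) ∂μ := by
        refine lintegral_congr fun ω => ?_
        by_cases h : ω ∈ s <;> simp [hψ, hY', h]
    _ = ∫⁻ p, ψ p ∂(μ.map fun ω => (Y' ω, Z ω)) :=
        (lintegral_map hψm (hY'm0.prodMk hZ)).symm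
    _ = ∫⁻ y, ∫⁻ e, ψ (y, e) ∂(μ.map Z) ∂(μ.map Y') := by
        rw [hprod, lintegral_prod _ hψm.aemeasurable]
    _ = ∫⁻ ω, ∫⁻ e, ψ (Y' ω, e) ∂(μ.map Z) ∂μ :=
        lintegral_map hψm.lintegral_prod_right' hY'm0
    _ = _ := by
        refine lintegral_congr fun ω => ?_
        by_cases h : ω ∈ s <;> simp [hψ, hY', h]

/-- The filtration generated by the samples drawn strictly before time `n`. -/
def pastFiltration {Ω E : Type*} {m0 : MeasurableSpace Ω} [mE : MeasurableSpace E]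
    (ξ : ℕ → Ω → E) (hξ : ∀ n, Measurable (ξ n)) : Filtration ℕ m0 where
  seq n := ⨆ i ∈ Set.Iio n, MeasurableSpace.comap (ξ i) mE
  mono' _ _ h := biSup_mono fun _ hi => lt_of_lt_of_le hi h
  le' _ := iSup₂_le fun i _ => (hξ i).comap_le

theorem indep_pastFiltration {Ω E : Type*} {m0 : MeasurableSpace Ω} [mE : MeasurableSpace E]
    {μ : Measure Ω} {ξ : ℕ → Ω → E} (hξ : ∀ n, Measurable (ξ n)) (hind : iIndepFun ξ μ) (n : ℕ) :
    Indep (pastFiltration ξ hξ n) (MeasurableSpace.comap (ξ n) mE) μ := by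
  have h := indep_iSup_of_disjoint (fun i => (hξ i).comap_le) hind
    (S := Set.Iio n) (T := {n}) (by simp)
  rwa [iSup_singleton] at h

variable {ι : Type*} [Fintype ι]

/-- A Lyapunov function for the noisy fixed point iteration of a contraction. -/
theorem exists_lyapunov (N : Seminorm ℝ (ι → ℝ)) {a b β : ℝ} (ha0 : 0 ≤ a)
    (ha : ∀ x, ‖x‖ ≤ a * N x) (hb : ∀ x, N x ≤ b * ‖x‖) (hβ0 : 0 ≤ β) (hβ : β < 1)
    {T : (ι → ℝ) → ι → ℝ} (hT : ∀ p q, N (T p - T q) ≤ β * N (p - q))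
    {qs : ι → ℝ} (hqs : T qs = qs)
    {E : Type*} [MeasurableSpace E] {ℓ : Measure E} [IsProbabilityMeasure ℓ]
    {F : E → (ι → ℝ) → ι → ℝ} (hL2 : ∀ q k, MemLp (fun e => F e q k) 2 ℓ)
    (hmean : ∀ q k, ∫ e, F e q k ∂ℓ = T q k) {C₀ : ℝ} (hC₀ : 0 ≤ C₀)
    (hvar : ∀ q k, variance (fun e => F e q k) ℓ ≤ C₀ * (1 + ‖q‖ ^ 2)) :
    ∃ (V : (ι → ℝ) → ℝ) (B c C : ℝ), Continuous V ∧ (∀ x, 0 ≤ V x) ∧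
      (∀ x, ‖x‖ ^ 2 ≤ B * V x) ∧ 0 < c ∧ 0 ≤ C ∧ ∀ q (t : ℝ), 0 ≤ t →
        0 ≤ (1 - c * t + C * t ^ 2) * V (q - qs) + C * t ^ 2 ∧
        ∫⁻ e, ENNReal.ofReal (V (q + t • (F e q - q) - qs)) ∂ℓ ≤
          ENNReal.ofReal ((1 - c * t + C * t ^ 2) * V (q - qs) + C * t ^ 2) := by
  have hβ2 : 0 < 1 - β ^ 2 := by nlinarith
  -- With this `κ`, `b ^ 2 / κ ≤ 1 - β ^ 2`, hence `β ^ 2 * B ≤ 1 - (1 - β ^ 2) ^ 2 < 1`. The `+ 1`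
  -- keeps `κ` positive when `b = 0`.
  set κ : ℝ := (b ^ 2 + 1) / (1 - β ^ 2) with hκdef
  have hκ : 0 < κ := by positivity
  obtain ⟨V, G, h1, h2, h3, h4, hVc⟩ := exists_moreau_envelope N hb hκ
  set B : ℝ := 1 + b ^ 2 / κ with hB
  have hB0 : 0 < B := by positivity
  have hBβ : β ^ 2 * B < 1 := by
    have : b ^ 2 / κ = b ^ 2 * (1 - β ^ 2) / (b ^ 2 + 1) := by
      rw [hκdef]; field_simp
    rw [hB, this]
    have h5 : b ^ 2 * (1 - β ^ 2) / (b ^ 2 + 1) ≤ 1 - β ^ 2 := by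
      rw [div_le_iff₀ (by positivity)]
      nlinarith
    nlinarith [sq_nonneg β]
  have hVnn : ∀ x, 0 ≤ V x := fun x => by
    have := (sq_nonneg (N x)).trans (h4 x)
    exact nonneg_of_mul_nonneg_right this hB0
  set M : ℝ := (Fintype.card ι : ℝ) with hM
  have hM0 : 0 ≤ M := Nat.cast_nonneg _
  have hnorm : ∀ x, ‖x‖ ^ 2 ≤ a ^ 2 * B * V x := fun x => by
    calc ‖x‖ ^ 2 ≤ (a * N x) ^ 2 := by gcongr; exact ha x
      _ = a ^ 2 * N x ^ 2 := by ring
      _ ≤ a ^ 2 * (B * V x) := by gcongr; exact h4 x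
      _ = a ^ 2 * B * V x := by ring
  -- The three terms come from the squared drift, from the part of the variance growing with `V`,
  -- and from the constant part of the variance.
  set C : ℝ := κ * (8 * M * (a ^ 2 * B) + 4 * M * C₀ * (a ^ 2 * B)
    + 2 * M * C₀ * (1 + 2 * ‖qs‖ ^ 2)) with hC
  refine ⟨V, a ^ 2 * B, 1 - β ^ 2 * B, C, hVc, hVnn, hnorm, by linarith, by positivity, ?_⟩
  intro q t ht
  set x : ι → ℝ := q - qs with hx
  set d : ι → ℝ := T q - q with hd
  set W : E → ι → ℝ := fun e => F e q - T q with hW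
  -- Negative drift: the tangent inequality bounds `G x ⬝ᵥ d` by `V (x + d) - V x`, and `x + d = T q
  -- - T qs` is contracted.
  have hGd : G x ⬝ᵥ d ≤ -(1 - β ^ 2 * B) * V x := by
    have h5 := h2 x (x + d)
    rw [add_sub_cancel_left] at h5
    have h6 : x + d = T q - T qs := by rw [hqs, hx, hd]; abel
    have h7 : V (x + d) ≤ β ^ 2 * B * V x := by
      calc V (x + d) ≤ N (x + d) ^ 2 := h3 _
        _ ≤ (β * N x) ^ 2 := by
          rw [h6]; gcongr; exact hT q qs
        _ = β ^ 2 * N x ^ 2 := by ring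
        _ ≤ β ^ 2 * (B * V x) := by gcongr; exact h4 x
        _ = _ := by ring
    linarith
  have hdd : d ⬝ᵥ d ≤ 4 * M * (a ^ 2 * B) * V x := by
    have h5 : N d ≤ 2 * N x := by
      have h6 : d = (T q - T qs) - x := by rw [hqs, hx, hd]; abel
      calc N d ≤ N (T q - T qs) + N x := by rw [h6]; exact map_sub_le_add N _ _
        _ ≤ β * N x + N x := by gcongr; exact hT q qs
        _ ≤ 2 * N x := by nlinarith [apply_nonneg N x]
    calc d ⬝ᵥ d ≤ M * ‖d‖ ^ 2 := dotProduct_self_le d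
      _ ≤ M * (a * (2 * N x)) ^ 2 := by
        gcongr
        exact (ha d).trans (by gcongr)
      _ = 4 * M * a ^ 2 * N x ^ 2 := by ring
      _ ≤ 4 * M * a ^ 2 * (B * V x) := by gcongr; exact h4 x
      _ = _ := by ring
  have hWmem : ∀ k, MemLp (fun e => W e k) 2 ℓ := fun k => (hL2 q k).sub (memLp_const _)
  have hWint : ∀ k, Integrable (fun e => W e k) ℓ := fun k => (hWmem k).integrable one_le_two
  have hW0 : ∀ k, ∫ e, W e k ∂ℓ = 0 := fun k => by
    simp only [hW, Pi.sub_apply]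
    rw [integral_sub ((hL2 q k).integrable one_le_two) (integrable_const _), hmean]
    simp
  have hGWint : Integrable (fun e => G x ⬝ᵥ W e) ℓ :=
    integrable_finsetSum _ fun k _ => (hWint k).const_mul _
  have hGW0 : ∫ e, G x ⬝ᵥ W e ∂ℓ = 0 := by
    simp only [dotProduct]
    rw [integral_finsetSum _ fun k _ => (hWint k).const_mul _]
    refine Finset.sum_eq_zero fun k _ => ?_
    rw [integral_const_mul, hW0, mul_zero]
  have hWsq : ∀ k, Integrable (fun e => W e k * W e k) ℓ := fun k => by
    simpa only [pow_two] using (hWmem k).integrable_sq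
  have hWWint : Integrable (fun e => W e ⬝ᵥ W e) ℓ := integrable_finsetSum _ fun k _ => hWsq k
  have hWW : ∫ e, W e ⬝ᵥ W e ∂ℓ ≤ M * (C₀ * (1 + (2 * (a ^ 2 * B * V x) + 2 * ‖qs‖ ^ 2))) := by
    have hq : ‖q‖ ^ 2 ≤ 2 * (a ^ 2 * B * V x) + 2 * ‖qs‖ ^ 2 := by
      have h5 : ‖q‖ ≤ ‖x‖ + ‖qs‖ := by
        simpa [hx] using norm_add_le (q - qs) qs
      have h6 := hnorm x
      nlinarith [norm_nonneg q, sq_nonneg (‖x‖ - ‖qs‖)]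
    simp only [dotProduct]
    rw [integral_finsetSum _ fun k _ => hWsq k]
    calc ∑ k, ∫ e, W e k * W e k ∂ℓ ≤ ∑ _k : ι, C₀ * (1 + ‖q‖ ^ 2) := by
          refine Finset.sum_le_sum fun k _ => ?_
          refine le_trans (le_of_eq ?_) (hvar q k)
          rw [variance_eq_integral (hL2 q k).aemeasurable, hmean]
          simp only [hW, Pi.sub_apply, pow_two]
      _ = M * (C₀ * (1 + ‖q‖ ^ 2)) := by simp [hM]
      _ ≤ _ := by gcongr
  set U : E → ℝ := fun e => ((1 - (1 - β ^ 2 * B) * t) * V x + 2 * κ * t ^ 2 * (d ⬝ᵥ d)) +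
    (t * (G x ⬝ᵥ W e) + 2 * κ * t ^ 2 * (W e ⬝ᵥ W e)) with hU
  have hnoise : Integrable (fun e => t * (G x ⬝ᵥ W e) + 2 * κ * t ^ 2 * (W e ⬝ᵥ W e)) ℓ :=
    (hGWint.const_mul _).add (hWWint.const_mul _)
  have hUint : Integrable U ℓ := (integrable_const _).add hnoise
  have hVU : ∀ e, V (q + t • (F e q - q) - qs) ≤ U e := by
    intro e
    have h5 : q + t • (F e q - q) - qs = x + t • (d + W e) := by
      simp only [hx, hd, hW]
      rw [show T q - q + (F e q - T q) = F e q - q by abel]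
      abel
    have h6 := h1 x (t • (d + W e))
    rw [← h5] at h6
    simp only [dotProduct_smul, smul_dotProduct, smul_eq_mul] at h6
    rw [dotProduct_add (G x)] at h6
    have h7 := mul_le_mul_of_nonneg_left (dotProduct_self_add_le d (W e))
      (by positivity : 0 ≤ κ * t ^ 2)
    have h8 := mul_le_mul_of_nonneg_left hGd ht
    simp only [hU]
    nlinarith
  have hUint_le : ∫ e, U e ∂ℓ ≤ (1 - (1 - β ^ 2 * B) * t + C * t ^ 2) * V x + C * t ^ 2 := by
    have h5 : ∫ e, U e ∂ℓ = ((1 - (1 - β ^ 2 * B) * t) * V x + 2 * κ * t ^ 2 * (d ⬝ᵥ d)) +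
        2 * κ * t ^ 2 * ∫ e, W e ⬝ᵥ W e ∂ℓ := by
      simp only [hU]
      rw [integral_add (integrable_const _) hnoise,
        integral_add (hGWint.const_mul _) (hWWint.const_mul _), integral_const_mul,
        integral_const_mul, hGW0]
      simp
    rw [h5]
    have h6 := mul_le_mul_of_nonneg_left hdd (by positivity : 0 ≤ 2 * κ * t ^ 2)
    have h7 := mul_le_mul_of_nonneg_left hWW (by positivity : 0 ≤ 2 * κ * t ^ 2)
    have h8 : 0 ≤ t ^ 2 * (κ * (8 * M * (a ^ 2 * B) + 4 * M * C₀ * (a ^ 2 * B))) := by positivity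
    have h9 : 0 ≤ t ^ 2 * (κ * (2 * M * C₀ * (1 + 2 * ‖qs‖ ^ 2))) * V x := by
      have := hVnn x
      positivity
    rw [hC]
    linarith
  have hU0 : ∀ e, 0 ≤ U e := fun e => (hVnn _).trans (hVU e)
  -- Nonnegativity comes from dominating the integral of `U ≥ 0`; the sign of the coefficient of `V`
  -- plays no role.
  refine ⟨(integral_nonneg hU0).trans hUint_le, ?_⟩
  calc ∫⁻ e, ENNReal.ofReal (V (q + t • (F e q - q) - qs)) ∂ℓ
      ≤ ∫⁻ e, ENNReal.ofReal (U e) ∂ℓ := lintegral_mono fun e => ENNReal.ofReal_le_ofReal (hVU e)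
    _ = ENNReal.ofReal (∫ e, U e ∂ℓ) :=
      (ofReal_integral_eq_lintegral_ofReal hUint (ae_of_all _ hU0)).symm
    _ ≤ _ := ENNReal.ofReal_le_ofReal hUint_le

/-- Stochastic approximation of the fixed point of a contraction in an arbitrary norm, with
independent samples and noise whose variance grows at most quadratically. -/
theorem ae_tendsto_fixedPoint_of_contraction (N : Seminorm ℝ (ι → ℝ)) {a b β : ℝ} (ha0 : 0 ≤ a)
    (ha : ∀ x, ‖x‖ ≤ a * N x) (hb : ∀ x, N x ≤ b * ‖x‖) (hβ0 : 0 ≤ β) (hβ : β < 1)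
    {T : (ι → ℝ) → ι → ℝ} (hT : ∀ p q, N (T p - T q) ≤ β * N (p - q))
    {qs : ι → ℝ} (hqs : T qs = qs)
    {E : Type*} [MeasurableSpace E] {ℓ : Measure E}
    {F : E → (ι → ℝ) → ι → ℝ} (hF : Measurable (Function.uncurry F))
    (hL2 : ∀ q k, MemLp (fun e => F e q k) 2 ℓ)
    (hmean : ∀ q k, ∫ e, F e q k ∂ℓ = T q k) {C₀ : ℝ} (hC₀ : 0 ≤ C₀)
    (hvar : ∀ q k, variance (fun e => F e q k) ℓ ≤ C₀ * (1 + ‖q‖ ^ 2))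
    {γ : ℕ → ℝ} (hγ : ∀ n, 0 ≤ γ n)
    (hγ_sum : Tendsto (fun N => ∑ n ∈ Finset.range N, γ n) atTop atTop)
    (hγ_sq : Summable fun n => γ n ^ 2)
    {Ω : Type*} [MeasurableSpace Ω] {μ : Measure Ω} [IsProbabilityMeasure μ]
    {ξ : ℕ → Ω → E} (hξ : ∀ n, Measurable (ξ n)) (hlaw : ∀ n, μ.map (ξ n) = ℓ)
    (hind : iIndepFun ξ μ) {q₀ : ι → ℝ} {Q : ℕ → Ω → ι → ℝ} (hQ0 : ∀ ω, Q 0 ω = q₀)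
    (hQ : ∀ n ω, Q (n + 1) ω = Q n ω + γ n • (F (ξ n ω) (Q n ω) - Q n ω)) :
    ∀ᵐ ω ∂μ, Tendsto (fun n => Q n ω) atTop (𝓝 qs) := by
  have hℓ : IsProbabilityMeasure ℓ := by
    rw [← hlaw 0]; exact Measure.isProbabilityMeasure_map (hξ 0).aemeasurable
  obtain ⟨V, B, c, C, hVc, hVnn, hnorm, hc, hC, hstep⟩ :=
    exists_lyapunov N ha0 ha hb hβ0 hβ hT hqs hL2 hmean hC₀ hvar
  set ℱ := pastFiltration ξ hξ with hℱ
  -- `Q n` depends only on samples before time `n`, hence is independent of `ξ n`.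
  have hQm : ∀ n, Measurable[ℱ n] (Q n) := by
    intro n
    induction n with
    | zero =>
      rw [show Q 0 = fun _ => q₀ from funext hQ0]
      exact measurable_const
    | succ n ih =>
      have h1 : Measurable[ℱ (n + 1)] (Q n) := ih.mono (ℱ.mono n.le_succ) le_rfl
      have h2 : Measurable[ℱ (n + 1)] (ξ n) :=
        measurable_iff_comap_le.2 (le_biSup (fun i => MeasurableSpace.comap (ξ i) inferInstance)
          (Set.mem_Iio.2 n.lt_succ_self))
      have h3 : Measurable[ℱ (n + 1)] fun ω => F (ξ n ω) (Q n ω) := hF.comp (h2.prodMk h1)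
      rw [show Q (n + 1) = fun ω => Q n ω + γ n • (F (ξ n ω) (Q n ω) - Q n ω) from funext (hQ n)]
      exact h1.add ((h3.sub h1).const_smul (γ n))
  set v : ℕ → Ω → ℝ := fun n ω => V (Q n ω - qs) with hv
  have hadp : StronglyAdapted ℱ v := fun n =>
    (hVc.measurable.comp ((hQm n).sub_const qs)).stronglyMeasurable
  have hvm : ∀ n, Measurable (v n) := fun n => ((hadp n).mono (ℱ.le n)).measurable
  -- Stated in `ENNReal` first, so that integrability of `v (n + 1)` can be deduced inductively from
  -- this bound.
  have hlin : ∀ n s, MeasurableSet[ℱ n] s → ∫⁻ ω in s, ENNReal.ofReal (v (n + 1) ω) ∂μ ≤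
      ∫⁻ ω in s, ENNReal.ofReal ((1 - c * γ n + C * γ n ^ 2) * v n ω + C * γ n ^ 2) ∂μ := by
    intro n s hs
    set φ : (ι → ℝ) × E → ENNReal :=
      fun p => ENNReal.ofReal (V (p.1 + γ n • (F p.2 p.1 - p.1) - qs)) with hφ
    have hFm : Measurable fun p : (ι → ℝ) × E => F p.2 p.1 := hF.comp measurable_swap
    have hφm : Measurable φ := by
      refine (hVc.measurable.comp ?_).ennreal_ofReal
      exact (measurable_fst.add ((hFm.sub measurable_fst).const_smul (γ n))).sub_const qs
    have h1 := setLIntegral_comp_of_indep (ℱ.le n) (hQm n) (hξ n)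
      (indep_pastFiltration hξ hind n) hφm hs
    simp only [hφ] at h1
    simp only [hv, hQ]
    rw [h1, hlaw]
    exact lintegral_mono fun ω => (hstep (Q n ω) (γ n) (hγ n)).2
  have hint : ∀ n, Integrable (v n) μ := by
    intro n
    induction n with
    | zero => simp only [hv, hQ0]; exact integrable_const _
    | succ n ih =>
      have h1 : Integrable (fun ω => (1 - c * γ n + C * γ n ^ 2) * v n ω + C * γ n ^ 2) μ :=
        (ih.const_mul _).add (integrable_const _)
      have h2 := hlin n Set.univ MeasurableSet.univ
      simp only [Measure.restrict_univ] at h2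
      refine ⟨(hvm _).aestronglyMeasurable, ?_⟩
      rw [hasFiniteIntegral_iff_ofReal (ae_of_all _ fun ω => hVnn _)]
      refine h2.trans_lt ?_
      rw [← hasFiniteIntegral_iff_ofReal (ae_of_all _ fun ω => (hstep (Q n ω) (γ n) (hγ n)).1)]
      exact h1.2
  have hset : ∀ n s, MeasurableSet[ℱ n] s → ∫ ω in s, v (n + 1) ω ∂μ ≤
      ∫ ω in s, ((1 - c * γ n + C * γ n ^ 2) * v n ω + C * γ n ^ 2) ∂μ := by
    intro n s hs
    have h1 : Integrable (fun ω => (1 - c * γ n + C * γ n ^ 2) * v n ω + C * γ n ^ 2)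
        (μ.restrict s) := (((hint n).const_mul _).add (integrable_const _)).integrableOn
    have h0 : ∀ ω, 0 ≤ (1 - c * γ n + C * γ n ^ 2) * v n ω + C * γ n ^ 2 :=
      fun ω => (hstep (Q n ω) (γ n) (hγ n)).1
    have h2 := hlin n s hs
    rw [← ofReal_integral_eq_lintegral_ofReal (hint (n + 1)).integrableOn
      (ae_of_all _ fun ω => hVnn _),
      ← ofReal_integral_eq_lintegral_ofReal h1 (ae_of_all _ h0)] at h2
    exact (ENNReal.ofReal_le_ofReal_iff (integral_nonneg h0)).1 h2
  filter_upwards [ae_tendsto_zero_of_almost_supermartingale ℱ hadp hint (fun n ω => hVnn _) hγ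
    hγ_sum hγ_sq hc hC hset] with ω hω
  have h1 : Tendsto (fun n => ‖Q n ω - qs‖ ^ 2) atTop (𝓝 0) := by
    have h2 : Tendsto (fun n => B * v n ω) atTop (𝓝 0) := by simpa using hω.const_mul B
    exact squeeze_zero (fun n => sq_nonneg _) (fun n => hnorm _) h2
  rw [tendsto_iff_norm_sub_tendsto_zero]
  simpa [Real.sqrt_sq] using h1.sqrt

/-- Banach's argument, with geometric decay in `N` transferred to the ambient supremum norm, where
completeness is available. -/
theorem exists_fixedPoint_of_contraction (N : Seminorm ℝ (ι → ℝ)) {a b β : ℝ} (ha0 : 0 ≤ a)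
    (ha : ∀ x, ‖x‖ ≤ a * N x) (hb0 : 0 ≤ b) (hb : ∀ x, N x ≤ b * ‖x‖) (hβ0 : 0 ≤ β) (hβ : β < 1)
    {T : (ι → ℝ) → ι → ℝ} (hT : ∀ p q, N (T p - T q) ≤ β * N (p - q)) : ∃ q, T q = q := by
  have hTc : Continuous T := by
    refine (LipschitzWith.of_dist_le_mul (K := (a * β * b).toNNReal) fun p q => ?_).continuous
    rw [Real.coe_toNNReal _ (by positivity), dist_eq_norm, dist_eq_norm]
    calc ‖T p - T q‖ ≤ a * N (T p - T q) := ha _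
      _ ≤ a * (β * (b * ‖p - q‖)) := by
        gcongr
        exact (hT p q).trans (by gcongr; exact hb _)
      _ = _ := by ring
  have hN : ∀ n, N (T^[n] 0 - T^[n + 1] 0) ≤ β ^ n * N (0 - T 0) := by
    intro n
    induction n with
    | zero => simp
    | succ n ih =>
      rw [Function.iterate_succ_apply', Function.iterate_succ_apply' T (n + 1)]
      refine (hT _ _).trans ?_
      rw [pow_succ']
      nlinarith
  have hcau : CauchySeq fun n => T^[n] 0 := by
    refine cauchySeq_of_le_geometric β (a * N (0 - T 0)) hβ fun n => ?_
    rw [dist_eq_norm]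
    refine (ha _).trans ?_
    nlinarith [hN n]
  obtain ⟨q, hq⟩ := cauchySeq_tendsto_of_complete hcau
  exact ⟨q, isFixedPt_of_tendsto_iterate hq hTc.continuousAt⟩

end StochasticApproximation

/-! ### Decision rules and minimization over actions -/

section Actions

variable {X A : Type*} [Fintype A]

theorem le_sum_mul_of_le (p : stdSimplex ℝ A) {v : A → ℝ} {l : ℝ} (h : ∀ a, l ≤ v a) :
    l ≤ ∑ a, p a * v a := by
  calc l = ∑ a, p a * l := by rw [← Finset.sum_mul, stdSimplex.sum_eq_one, one_mul]
    _ ≤ _ := Finset.sum_le_sum fun a _ => mul_le_mul_of_nonneg_left (h a) (p.2.1 a)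

theorem sum_deterministic_mul (a : X → A) (x : X) (v : A → ℝ) :
    ∑ b, deterministic a x b * v b = v (a x) := by
  classical
  rw [Finset.sum_eq_single (a x)]
  · simp [deterministic]
  · intro b _ hb
    simp [deterministic, hb]
  · simp

/-- The finitely many strict inequalities between values of the limit hold along the sequence from
some index on, so an action that is not minimal in the limit is eventually not minimal. -/
theorem eventually_isGreedy_imp [Finite X] {q : ℕ → X × A → ℝ} {qs : X × A → ℝ}
    (hq : Tendsto q atTop (𝓝 qs)) : ∀ᶠ n in atTop, ∀ a, IsGreedy (q n) a → IsGreedy qs a := by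
  have h : ∀ x : X, ∀ b b' : A, ∀ᶠ n in atTop, qs (x, b') < qs (x, b) →
      q n (x, b') < q n (x, b) := by
    intro x b b'
    by_cases hlt : qs (x, b') < qs (x, b)
    · filter_upwards [(tendsto_pi_nhds.1 hq (x, b')).eventually_lt (tendsto_pi_nhds.1 hq (x, b))
        hlt] with n hn _ using hn
    · exact Eventually.of_forall fun n h' => absurd h' hlt
  simp only [← eventually_all] at h
  filter_upwards [h] with n hn a ha x b
  by_contra! hlt
  exact absurd (ha x b) (not_le.2 (hn x (a x) b hlt))

variable [Nonempty A]

theorem minAct_le (q : X × A → ℝ) (x : X) (a : A) : minAct q x ≤ q (x, a) :=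
  Finset.inf'_le _ (Finset.mem_univ a)

theorem exists_minAct_eq (q : X × A → ℝ) (x : X) : ∃ a, q (x, a) = minAct q x := by
  obtain ⟨a, -, ha⟩ := Finset.exists_mem_eq_inf' Finset.univ_nonempty fun a => q (x, a)
  exact ⟨a, ha.symm⟩

theorem minAct_le_add {p q : X × A → ℝ} {l : ℝ} (h : ∀ k, p k ≤ q k + l) (x : X) :
    minAct p x ≤ minAct q x + l := by
  obtain ⟨a, ha⟩ := exists_minAct_eq q x
  rw [← ha]
  exact (minAct_le p x a).trans (h _)

end Actions

/-- The factor is `T + 1` because the `T`-stage risk contains `T + 1` stage costs, although it is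
divided by `T`. -/
theorem tendsto_affine_div (g B : ℝ) :
    Tendsto (fun T : ℕ => ((1 / (T : ℝ) * ((T + 1) * g + B) : ℝ) : EReal)) atTop
      (𝓝 (g : EReal)) := by
  refine (continuous_coe_real_ereal.tendsto g).comp ?_
  have h1 : Tendsto (fun T : ℕ => g + 1 / (T : ℝ) * (g + B)) atTop (𝓝 (g + 0 * (g + B))) :=
    tendsto_const_nhds.add (tendsto_one_div_atTop_nhds_zero_nat.mul_const _)
  rw [zero_mul, add_zero] at h1
  refine h1.congr' ?_
  filter_upwards [eventually_gt_atTop 0] with T hT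
  have : (T : ℝ) ≠ 0 := by positivity
  field_simp
  ring

/-! ### Risk maps, span contraction of the Bellman operator, and the span norm -/

section RiskMaps

variable {X A : Type*} [Fintype X]

theorem IsMonetary.mono_of_le {p : stdSimplex ℝ X} {ρ : (X → ℝ) → ℝ} (hρ : IsMonetary p ρ)
    {v w : X → ℝ} (h : v ≤ w) : ρ v ≤ ρ w :=
  hρ.mono v w fun y _ => h y

theorem IsMonetary.le_add {p : stdSimplex ℝ X} {ρ : (X → ℝ) → ℝ} (hρ : IsMonetary p ρ)
    {v w : X → ℝ} {l : ℝ} (h : ∀ y, v y ≤ w y + l) : ρ v ≤ ρ w + l := by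
  rw [← hρ.translation]
  exact hρ.mono_of_le h

section Bellman

variable [Fintype A] [Nonempty A]

variable {P : X → A → stdSimplex ℝ X} {c : X → A → ℝ} {R : X → A → (X → ℝ) → ℝ}

theorem bellmanQ_apply (hR : IsRiskMap P R) (q : X × A → ℝ) (k : X × A) :
    bellmanQ c R q k = c k.1 k.2 + R k.1 k.2 (minAct q) := by
  simp only [bellmanQ, add_comm (c k.1 k.2)]
  rw [(hR k.1 k.2).translation]

theorem bellmanQ_le_add (hR : IsRiskMap P R) {p q : X × A → ℝ} {l : ℝ}
    (h : ∀ k, p k ≤ q k + l) (k : X × A) : bellmanQ c R p k ≤ bellmanQ c R q k + l := by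
  rw [bellmanQ_apply hR, bellmanQ_apply hR, add_assoc]
  exact add_le_add_right ((hR _ _).le_add fun y => minAct_le_add h y) _

theorem bellmanQ_add_const (hR : IsRiskMap P R) (q : X × A → ℝ) (l : ℝ) (k : X × A) :
    bellmanQ c R (fun k => q k + l) k = bellmanQ c R q k + l := by
  refine le_antisymm (bellmanQ_le_add hR (fun k => le_rfl) k) ?_
  have := bellmanQ_le_add (c := c) hR (p := q) (q := fun k => q k + l) (l := -l)
    (fun k => by simp) k
  linarith

theorem abs_bellmanQ_sub_le (hR : IsRiskMap P R) (p q : X × A → ℝ) (k : X × A) :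
    |bellmanQ c R p k - bellmanQ c R q k| ≤ ‖p - q‖ := by
  have hk : ∀ k, |p k - q k| ≤ ‖p - q‖ := fun k => norm_le_pi_norm (p - q) k
  rw [abs_sub_le_iff]
  constructor
  · have := bellmanQ_le_add (c := c) hR (p := p) (q := q) (l := ‖p - q‖)
      (fun k => by linarith [(abs_sub_le_iff.1 (hk k)).1]) k
    linarith
  · have := bellmanQ_le_add (c := c) hR (p := q) (q := p) (l := ‖p - q‖)
      (fun k => by linarith [(abs_sub_le_iff.1 (hk k)).2]) k
    linarith

/-- Under the Doeblin condition the Bellman operator contracts the span seminorm. -/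
theorem exists_bellmanQ_span_contraction [Nonempty X] (hR : IsRiskMap P R) (hD : Doeblin R) :
    ∃ α : ℝ, 0 < α ∧ α < 1 ∧ ∀ (p q : X × A → ℝ) (s : ℝ),
      (∀ k k', (p k - q k) - (p k' - q k') ≤ s) → ∀ k k',
      (bellmanQ c R p k - bellmanQ c R q k) - (bellmanQ c R p k' - bellmanQ c R q k') ≤
        (1 - α) * s := by
  obtain ⟨p₀, ν, α, hν, hα0, hα1, h⟩ := hD
  have key : ∀ (v w : X → ℝ) (l : ℝ), (∀ y, v y ≤ w y + l) → ∀ x a,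
      R x a v - R x a w ≤ (1 - α) * l + α * (ν v - ν w) := by
    intro v w l hvw x a
    have h1 := h (fun y => w y + l) v hvw x a
    rw [(hR x a).translation, hν.translation] at h1
    linarith
  refine ⟨α, hα0, hα1, fun p q s hs k k' => ?_⟩
  obtain ⟨i, hi⟩ := Finite.exists_max fun k => p k - q k
  obtain ⟨j, hj⟩ := Finite.exists_min fun k => p k - q k
  have h1 := key (minAct p) (minAct q) (p i - q i)
    (minAct_le_add fun k => by linarith [hi k]) k.1 k.2
  have h2 := key (minAct q) (minAct p) (-(p j - q j))
    (minAct_le_add fun k => by linarith [hj k]) k'.1 k'.2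
  simp only [bellmanQ_apply hR]
  have h3 := mul_le_mul_of_nonneg_left (hs i j) (by linarith : 0 ≤ 1 - α)
  linarith

end Bellman

/-- The differences of the coordinates, scaled by `K`, together with one coordinate. -/
def spanEmbedding {ι : Type*} (K : ℝ) (k₀ : ι) : (ι → ℝ) →ₗ[ℝ] (ι × ι → ℝ) × ℝ where
  toFun q := (fun i => K * (q i.1 - q i.2), q k₀)
  map_add' p q := by
    ext i
    · simp; ring
    · simp
  map_smul' r q := by
    ext i
    · simp; ring
    · simp

/-- The norm `max (K * span q) |q k₀|`. -/
noncomputable def spanNorm {ι : Type*} [Fintype ι] (K : ℝ) (k₀ : ι) : Seminorm ℝ (ι → ℝ) :=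
  (normSeminorm ℝ ((ι × ι → ℝ) × ℝ)).comp (spanEmbedding K k₀)

section SpanNorm

variable {ι : Type*} [Fintype ι] {K : ℝ} {k₀ : ι}

theorem spanNorm_le_iff {q : ι → ℝ} {r : ℝ} (hr : 0 ≤ r) :
    spanNorm K k₀ q ≤ r ↔ (∀ i j, K * (q i - q j) ≤ r) ∧ |q k₀| ≤ r := by
  change ‖spanEmbedding K k₀ q‖ ≤ r ↔ _
  rw [Prod.norm_def, max_le_iff, pi_norm_le_iff_of_nonneg hr]
  refine and_congr ⟨fun h i j => ?_, fun h i => ?_⟩ Iff.rfl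
  · exact (le_abs_self _).trans (h (i, j))
  · refine abs_le'.2 ⟨h i.1 i.2, ?_⟩
    change -(K * (q i.1 - q i.2)) ≤ r
    linarith [h i.2 i.1]

theorem mul_sub_le_spanNorm (q : ι → ℝ) (i j : ι) :
    K * (q i - q j) ≤ spanNorm K k₀ q :=
  ((spanNorm_le_iff (apply_nonneg _ q)).1 le_rfl).1 i j

theorem abs_le_spanNorm (q : ι → ℝ) : |q k₀| ≤ spanNorm K k₀ q :=
  ((spanNorm_le_iff (apply_nonneg _ q)).1 le_rfl).2

theorem norm_le_spanNorm (hK : 1 ≤ K) (q : ι → ℝ) : ‖q‖ ≤ 2 * spanNorm K k₀ q := by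
  have h0 : 0 ≤ spanNorm K k₀ q := apply_nonneg _ q
  have hdiff : ∀ i j, q i - q j ≤ spanNorm K k₀ q := fun i j => by
    have h1 := mul_sub_le_spanNorm (K := K) (k₀ := k₀) q i j
    by_contra! h2
    nlinarith
  have h2 := abs_le.1 (abs_le_spanNorm (K := K) (k₀ := k₀) q)
  refine (pi_norm_le_iff_of_nonneg (by positivity)).2 fun k => ?_
  rw [Real.norm_eq_abs, abs_le]
  constructor <;> linarith [hdiff k k₀, hdiff k₀ k]

theorem spanNorm_le_norm (hK : 1 ≤ K) (q : ι → ℝ) : spanNorm K k₀ q ≤ 2 * K * ‖q‖ := by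
  have hq : ∀ k, |q k| ≤ ‖q‖ := norm_le_pi_norm q
  refine (spanNorm_le_iff (by positivity)).2 ⟨fun i j => ?_, ?_⟩
  · have h1 := abs_le.1 (hq i)
    have h2 := abs_le.1 (hq j)
    nlinarith
  · have := hq k₀
    nlinarith [norm_nonneg q]

end SpanNorm

/-! ### Contraction of the relative operator, the AROE, and optimality of greedy policies -/

section Policies

variable [Fintype A]
variable {P : X → A → stdSimplex ℝ X} {c : X → A → ℝ} {R : X → A → (X → ℝ) → ℝ}

/-- The relative value iteration operator `q ↦ H(q) - f(q)` is a contraction in the norm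
`max (K * span q) |q k₀|` for large `K`. -/
theorem exists_contraction [Nonempty X] [Nonempty A] (hR : IsRiskMap P R) (hD : Doeblin R)
    {f : (X × A → ℝ) → ℝ}
    (hf_trans : ∀ (q : X × A → ℝ) (l : ℝ), f (fun k => q k + l) = f q + l)
    (hf_lip : ∃ L : ℝ, 0 ≤ L ∧ ∀ p q : X × A → ℝ, |f p - f q| ≤ L * ‖p - q‖) (k₀ : X × A) :
    ∃ K β : ℝ, 1 ≤ K ∧ 0 ≤ β ∧ β < 1 ∧ ∀ p q : X × A → ℝ,
      spanNorm K k₀ ((fun k => bellmanQ c R p k - f p) - fun k => bellmanQ c R q k - f q) ≤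
        β * spanNorm K k₀ (p - q) := by
  obtain ⟨α, hα0, hα1, hspan⟩ := exists_bellmanQ_span_contraction (c := c) hR hD
  obtain ⟨L, hL0, hL⟩ := hf_lip
  have hα : 0 < 1 - α := by linarith
  have hK : 1 ≤ (1 + L) / (1 - α) := by rw [le_div_iff₀ hα]; linarith
  -- At `k₀` the operator moves by at most `(1 + L)` times the span of `p - q`; this `K` makes that
  -- `(1 - α) K` times the span, the same rate as in the span part.
  refine ⟨(1 + L) / (1 - α), 1 - α, hK, hα.le, by linarith, fun p q => ?_⟩
  set K := (1 + L) / (1 - α) with hKdef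
  have hK0 : 0 < K := by linarith
  set r := spanNorm K k₀ (p - q) with hr
  have hr0 : 0 ≤ r := apply_nonneg _ _
  have hs : ∀ k k', (p k - q k) - (p k' - q k') ≤ r / K := fun k k' => by
    rw [le_div_iff₀ hK0, mul_comm]
    exact mul_sub_le_spanNorm (p - q) k k'
  refine (spanNorm_le_iff (by positivity)).2 ⟨fun i j => ?_, ?_⟩
  · have h1 := mul_le_mul_of_nonneg_left (hspan p q _ hs i j) hK0.le
    have h2 : K * ((1 - α) * (r / K)) = (1 - α) * r := by field_simp
    simp only [Pi.sub_apply]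
    linarith
  -- The operator ignores constants, so both arguments may be normalized to vanish at `k₀`; their
  -- supremum distance is then at most the span of `p - q`.
  · set p' : X × A → ℝ := fun k => p k + -p k₀ with hp'
    set q' : X × A → ℝ := fun k => q k + -q k₀ with hq'
    have h1 : ‖p' - q'‖ ≤ r / K := by
      refine (pi_norm_le_iff_of_nonneg (by positivity)).2 fun k => ?_
      simp only [hp', hq', Pi.sub_apply, Real.norm_eq_abs]
      rw [abs_le]
      constructor <;> linarith [hs k k₀, hs k₀ k]
    have h2 := abs_le.1 (abs_bellmanQ_sub_le (c := c) hR p' q' k₀)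
    have h3 := abs_le.1 (hL p' q')
    have h4 : bellmanQ c R p' k₀ = bellmanQ c R p k₀ + -p k₀ := bellmanQ_add_const hR _ _ _
    have h5 : bellmanQ c R q' k₀ = bellmanQ c R q k₀ + -q k₀ := bellmanQ_add_const hR _ _ _
    have h6 : f p' = f p + -p k₀ := hf_trans _ _
    have h7 : f q' = f q + -q k₀ := hf_trans _ _
    have h8 : ‖p' - q'‖ + L * ‖p' - q'‖ ≤ (1 - α) * r := by
      calc ‖p' - q'‖ + L * ‖p' - q'‖ = (1 + L) * ‖p' - q'‖ := by ring
        _ ≤ (1 + L) * (r / K) := by gcongr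
        _ = (1 - α) * r := by rw [hKdef]; field_simp
    simp only [Pi.sub_apply]
    rw [abs_le]
    constructor <;> linarith

theorem solvesAROE_of_fixedPoint [Nonempty A] (hR : IsRiskMap P R) {q : X × A → ℝ} {g : ℝ}
    (hq : ∀ k, bellmanQ c R q k - g = q k) : SolvesAROE c R g (minAct q) := by
  intro x
  have h : ∀ a, c x a + R x a (minAct q) = q (x, a) + g := fun a => by
    rw [← hq (x, a), bellmanQ_apply hR]; ring
  simp only [h]
  refine le_antisymm (Finset.le_inf' _ _ fun a _ => by linarith [minAct_le q x a]) ?_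
  obtain ⟨a, ha⟩ := exists_minAct_eq q x
  refine (Finset.inf'_le _ (Finset.mem_univ a)).trans ?_
  rw [ha, add_comm]

/-- Peel off the first stage, then use monotonicity and translation. The loss `M` arises only at the
last stage, which has no continuation risk while the hypothesis on `g` includes `R x a h ≤ M`. -/
theorem le_totalRisk (hR : IsRiskMap P R) {h : X → ℝ} {g M : ℝ}
    (hg : ∀ x a, g + h x ≤ c x a + R x a h) (hM : ∀ x, h x ≤ M) (T : ℕ) (π : Policy X A) (x : X) :
    (T + 1) * g + h x - M ≤ totalRisk c R T π x := by
  induction T generalizing π x with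
  | zero =>
    refine le_sum_mul_of_le _ fun a => ?_
    have h1 : R x a h ≤ 0 + M := by
      rw [← (hR x a).normalized]
      exact (hR x a).le_add fun y => by simpa using hM y
    have := hg x a
    push_cast
    linarith
  | succ T ih =>
    rw [totalRisk, ← Finset.sum_add_distrib]
    simp only [← mul_add]
    refine le_sum_mul_of_le _ fun a => ?_
    have h1 := (hR x a).le_add (v := h) (w := totalRisk c R T fun t => π (t + 1))
      (l := M - (T + 1) * g) fun y => by linarith [ih (fun t => π (t + 1)) y]
    have := hg x a
    push_cast
    linarith

theorem totalRisk_stationary_le (hR : IsRiskMap P R) {h : X → ℝ} {g m : ℝ} {a : X → A}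
    (hg : ∀ x, c x (a x) + R x (a x) h = g + h x) (hm : ∀ x, m ≤ h x) (T : ℕ) (x : X) :
    totalRisk c R T (stationary (deterministic a)) x ≤ (T + 1) * g + h x - m := by
  induction T generalizing x with
  | zero =>
    simp only [totalRisk, stationary, sum_deterministic_mul]
    have h1 : 0 ≤ R x (a x) h + -m := by
      rw [← (hR x (a x)).normalized]
      exact (hR x (a x)).le_add fun y => by simpa using hm y
    have := hg x
    push_cast
    linarith
  | succ T ih =>
    have e : (fun t => stationary (deterministic a) (t + 1)) =
      stationary (deterministic (X := X) a) := rfl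
    rw [totalRisk, e]
    simp only [stationary, sum_deterministic_mul]
    have h1 := (hR x (a x)).le_add
      (v := totalRisk c R T (stationary (deterministic a))) (w := h)
      (l := (T + 1) * g - m) fun y => by linarith [ih y]
    have := hg x
    push_cast
    linarith

theorem le_averageRisk [Nonempty X] (hR : IsRiskMap P R) {h : X → ℝ} {g : ℝ}
    (hg : ∀ x a, g + h x ≤ c x a + R x a h) (π : Policy X A) (x : X) :
    (g : EReal) ≤ averageRisk c R π x := by
  obtain ⟨y, hy⟩ := Finite.exists_max h
  rw [← (tendsto_affine_div g (h x - h y)).limsup_eq]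
  refine limsup_le_limsup (Eventually.of_forall fun T => ?_)
  rw [EReal.coe_le_coe_iff]
  gcongr
  linarith [le_totalRisk hR hg hy T π x]

theorem averageRisk_stationary_le [Nonempty X] (hR : IsRiskMap P R) {h : X → ℝ} {g : ℝ}
    {a : X → A} (hg : ∀ x, c x (a x) + R x (a x) h = g + h x) (x : X) :
    averageRisk c R (stationary (deterministic a)) x ≤ (g : EReal) := by
  obtain ⟨y, hy⟩ := Finite.exists_min h
  rw [← (tendsto_affine_div g (h x - h y)).limsup_eq]
  refine limsup_le_limsup (Eventually.of_forall fun T => ?_)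
  rw [EReal.coe_le_coe_iff]
  gcongr
  linarith [totalRisk_stationary_le hR hg hy T x]

/-- The constant `g` bounds the average risk of every policy from below, and greedy actions attain
equality in the AROE, so their stationary policy does not exceed `g`. -/
theorem isOptimalPolicy_of_isGreedy [Nonempty X] [Nonempty A] (hR : IsRiskMap P R) {q : X × A → ℝ} {g : ℝ}
    (hq : ∀ k, bellmanQ c R q k - g = q k) {a : X → A} (ha : IsGreedy q a) :
    IsOptimalPolicy c R (stationary (deterministic a)) := by
  have hqv : ∀ x b, c x b + R x b (minAct q) = g + q (x, b) := fun x b => by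
    rw [← hq (x, b), bellmanQ_apply hR]; ring
  have hle : ∀ x b, g + minAct q x ≤ c x b + R x b (minAct q) := fun x b => by
    rw [hqv]; linarith [minAct_le q x b]
  have heq : ∀ x, c x (a x) + R x (a x) (minAct q) = g + minAct q x := fun x => by
    obtain ⟨b, hb⟩ := exists_minAct_eq q x
    rw [hqv, le_antisymm (hb ▸ ha x b) (minAct_le q x (a x))]
  intro x
  refine le_antisymm (le_iInf fun π => ?_) (iInf_le _ _)
  exact (averageRisk_stationary_le hR heq x).trans (le_averageRisk hR hle π x)

end Policies

end RiskMaps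

end RiskAware

/-! ### Assembly of the convergence theorem -/

theorem mainTheorem3
    {X A : Type*} [Fintype X] [Nonempty X] [Fintype A] [Nonempty A]
    -- the MDP and the risk map
    (P : X → A → stdSimplex ℝ X) (c : X → A → ℝ) (R : X → A → (X → ℝ) → ℝ)
    (hR : RiskAware.IsRiskMap P R)
    (hDoeblin : RiskAware.Doeblin R)
    (hCoh : RiskAware.AsymptoticallyCoherent P R)
    -- the function f
    (f : (X × A → ℝ) → ℝ)
    (hf_zero : f 0 = 0)
    (hf_trans : ∀ (q : X × A → ℝ) (l : ℝ), f (fun k => q k + l) = f q + l)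
    (hf_lip : ∃ L : ℝ, 0 ≤ L ∧ ∀ p q : X × A → ℝ, |f p - f q| ≤ L * ‖p - q‖)
    (hf_hom : ∀ (l : ℝ) (q : X × A → ℝ), f (l • q) = l * f q)
    -- the step sizes
    (γ : ℕ → ℝ) (hγ_nonneg : ∀ n, 0 ≤ γ n)
    (hγ_sum : Tendsto (fun N => ∑ n ∈ Finset.range N, γ n) atTop atTop)
    (hγ_sq : Summable fun n => γ n ^ 2)
    -- the estimator, and the independent samples of law ℓ that drive it
    {E : Type*} [MeasurableSpace E] (ℓ : Measure E)
    (Hhat : E → (X × A → ℝ) → (X × A → ℝ))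
    (hHhat_meas : Measurable (Function.uncurry Hhat))
    (hHhat : RiskAware.IsUnbiasedEstimator ℓ Hhat (RiskAware.bellmanQ c R))
    {Ω : Type*} [MeasurableSpace Ω] (μ : Measure Ω) [IsProbabilityMeasure μ]
    (ξ : ℕ → Ω → E) (hξ_meas : ∀ n, Measurable (ξ n))
    (hξ_law : ∀ n, μ.map (ξ n) = ℓ) (hξ_indep : iIndepFun ξ μ)
    -- the iterates, from an arbitrary starting point
    (q₀ : X × A → ℝ) (Q : ℕ → Ω → X × A → ℝ)
    (hQ : ∀ n ω, Q n ω = RiskAware.qIter Hhat f γ q₀ (fun i => ξ i ω) n) :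
    ∃ Qstar : X × A → ℝ,
      RiskAware.SolvesAROE c R (f Qstar) (RiskAware.minAct Qstar) ∧
      (∀ a : X → A, RiskAware.IsGreedy Qstar a →
        RiskAware.IsOptimalPolicy c R (RiskAware.stationary (RiskAware.deterministic a))) ∧
      ∀ᵐ ω ∂μ,
        Tendsto (fun n => Q n ω) atTop (𝓝 Qstar) ∧
        ∀ a : ℕ → X → A, (∀ n, RiskAware.IsGreedy (Q n ω) (a n)) →
          (∀ᶠ n in atTop, RiskAware.IsGreedy Qstar (a n) ∧
            RiskAware.IsOptimalPolicy c R
              (RiskAware.stationary (RiskAware.deterministic (a n)))) ∧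
          (∀ astar : X → A,
            (∀ x b, b ≠ astar x → Qstar (x, astar x) < Qstar (x, b)) →
            Tendsto (fun n => RiskAware.deterministic (a n)) atTop
              (𝓝 (RiskAware.deterministic astar))) := by
  obtain ⟨C, hC, hvar⟩ := hHhat.2
  have hmem := fun q k => (hHhat.1 q k).1
  have hH := fun q k => (hHhat.1 q k).2
  have hℓ : IsProbabilityMeasure ℓ := by
    rw [← hξ_law 0]; exact Measure.isProbabilityMeasure_map (hξ_meas 0).aemeasurable
  have hfm : Measurable f := by
    obtain ⟨L, hL0, hL⟩ := hf_lip
    refine (LipschitzWith.of_dist_le_mul (K := L.toNNReal) fun p q => ?_).continuous.measurable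
    rw [Real.coe_toNNReal _ hL0, dist_eq_norm, dist_eq_norm]
    exact hL p q
  obtain ⟨K, β, hK, hβ0, hβ1, hT⟩ := RiskAware.exists_contraction (c := c) hR hDoeblin hf_trans
    hf_lip (Classical.arbitrary (X × A))
  obtain ⟨Qstar, hQstar⟩ := RiskAware.exists_fixedPoint_of_contraction _ zero_le_two
    (RiskAware.norm_le_spanNorm hK) (by positivity) (RiskAware.spanNorm_le_norm hK) hβ0 hβ1 hT
  have hfix : ∀ k, RiskAware.bellmanQ c R Qstar k - f Qstar = Qstar k := congrFun hQstar
  refine ⟨Qstar, RiskAware.solvesAROE_of_fixedPoint hR hfix,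
    fun a ha => RiskAware.isOptimalPolicy_of_isGreedy hR hfix ha, ?_⟩
  have hconv : ∀ᵐ ω ∂μ, Tendsto (fun n => Q n ω) atTop (𝓝 Qstar) := by
    -- For fixed `q` the term `f q` is deterministic, so subtracting it from the estimator shifts
    -- the mean and leaves the variance unchanged.
    refine RiskAware.ae_tendsto_fixedPoint_of_contraction _ zero_le_two
      (RiskAware.norm_le_spanNorm hK) (RiskAware.spanNorm_le_norm hK) hβ0 hβ1 hT
      hQstar (F := fun e q k => Hhat e q k - f q) ?_ (fun q k => (hmem q k).sub (memLp_const _))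
      (fun q k => ?_) hC.le (fun q k => ?_) hγ_nonneg hγ_sum hγ_sq hξ_meas hξ_law hξ_indep
      (q₀ := q₀) (fun ω => ?_) fun n ω => ?_
    · exact measurable_pi_lambda _ fun k =>
        ((measurable_pi_apply k).comp hHhat_meas).sub (hfm.comp measurable_snd)
    · rw [integral_sub ((hmem q k).integrable one_le_two) (integrable_const _), hH]
      simp
    · rw [variance_sub_const (hmem q k).aestronglyMeasurable]
      exact hvar q k
    · rw [hQ]; rfl
    · ext k
      simp only [hQ, RiskAware.qIter, Pi.add_apply, Pi.smul_apply, Pi.sub_apply, smul_eq_mul]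
  filter_upwards [hconv] with ω hω
  refine ⟨hω, fun a ha => ?_⟩
  have hgreedy : ∀ᶠ n in atTop, RiskAware.IsGreedy Qstar (a n) := by
    filter_upwards [RiskAware.eventually_isGreedy_imp hω] with n hn using hn _ (ha n)
  refine ⟨hgreedy.mono fun n hn => ⟨hn, RiskAware.isOptimalPolicy_of_isGreedy hR hfix hn⟩,
    fun astar hastar => ?_⟩
  -- With a unique minimizer in every state, the greedy rules are eventually equal to `astar`.
  refine tendsto_const_nhds.congr' ?_
  filter_upwards [hgreedy] with n hn
  congr 1
  funext x
  by_contra hne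
  exact absurd (hn x (astar x)) (not_le.2 (hastar x _ (Ne.symm hne)))
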